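/- For a set $E\subset\mathbb{R}^2$, $s\in(0,1)$ and $x\in\partial E$, let $$H^s_{\partial E}(x):=\lim_{\varepsilon\to0^+}\int_{\mathbb{R}^2\setminus B_\varepsilon(x)}\frac{\chi_{E^c}(y)-\chi_E(y)}{|x-y|^{2+s}}\,dy$$ whenever this limit exists. For $p\ge 1$ let $$\hat{\mathscr{W}}_{s,p}(E):=\int_{\partial E}\left|H^s_{\partial E}(x)\right|^p\,d\sigma^1(x)$$ if $E$ is measurable and $H^s_{\partial E}(x)$ exists for $\sigma^1$-a.e. $x\in\partial E$, where $\sigma^1$ is the one-dimensional Hausdorff measure, and $\hat{\mathscr{W}}_{s,p}(E):=+\infty$ otherwise. Theorem. Let $E\subset\mathbb{R}^2$ be a bounded and convex set with nonempty interior. If for some $s\in(0,1)$ and some $p\ge\frac1s$ $$\hat{\mathscr{W}}_{s,p}(E)<+\infty,$$ then $\partial E$ is $C^1$; that is, around every point of $\partial E$, in suitable orthonormal coordinates, $\partial E$ is the graph of a $C^1$ function and the interior of $E$ is the region strictly above that graph. -/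

import Mathlib

open Filter Topology MeasureTheory
open scoped ENNReal

noncomputable section

/-- The Euclidean plane. -/
abbrev Plane : Type := EuclideanSpace ℝ (Fin 2)

/-- The truncated integral `∫_{ℝ² \ B_ε(x)} (χ_{Eᶜ}(y) - χ_E(y)) / |x - y|^{2+s} dy`. -/
def truncatedCurvature (s : ℝ) (E : Set Plane) (x : Plane) (ε : ℝ) : ℝ :=
  ∫ y in (Metric.ball x ε)ᶜ,
    (Eᶜ.indicator (fun _ => (1 : ℝ)) y - E.indicator (fun _ => (1 : ℝ)) y) / ‖x - y‖ ^ (2 + s)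

/-- The nonlocal mean curvature of `∂E` at `x` exists and equals `H`: the principal value
`lim_{ε → 0⁺} ∫_{ℝ² \ B_ε(x)} (χ_{Eᶜ}(y) - χ_E(y)) / |x - y|^{2+s} dy` exists and equals `H`. -/
def HasNonlocalMeanCurvature (s : ℝ) (E : Set Plane) (x : Plane) (H : ℝ) : Prop :=
  Tendsto (truncatedCurvature s E x) (𝓝[>] 0) (𝓝 H)

/-- The nonlocal mean curvature `H^s_{∂E}(x)`. It is meaningful wherever the principal value
exists. -/
def nonlocalMeanCurvature (s : ℝ) (E : Set Plane) (x : Plane) : ℝ :=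
  limUnder (𝓝[>] 0) (truncatedCurvature s E x)

theorem HasNonlocalMeanCurvature.eq {s : ℝ} {E : Set Plane} {x : Plane} {H : ℝ}
    (h : HasNonlocalMeanCurvature s E x H) : nonlocalMeanCurvature s E x = H :=
  Tendsto.limUnder_eq h

open Classical in
/-- The nonlocal Willmore energy `∫_{∂E} |H^s_{∂E}(x)|^p dσ¹(x)`, where `σ¹` is the
one-dimensional Hausdorff measure. It is `+∞` unless `E` is (Lebesgue) measurable and
`H^s_{∂E}(x)` exists for `σ¹`-a.e. `x ∈ ∂E`. -/
def nonlocalWillmoreEnergy (s p : ℝ) (E : Set Plane) : ℝ≥0∞ :=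
  if NullMeasurableSet E volume ∧
      ∀ᵐ x ∂((Measure.hausdorffMeasure 1 : Measure Plane).restrict (frontier E)),
        ∃ H : ℝ, HasNonlocalMeanCurvature s E x H then
    ∫⁻ x in frontier E, ENNReal.ofReal (|nonlocalMeanCurvature s E x| ^ p)
      ∂(Measure.hausdorffMeasure 1 : Measure Plane)
  else ∞

/-- The boundary of `E` is `C¹`: around each boundary point, in suitable orthonormal coordinates,
`∂E` is the graph of a `C¹` function and the interior of `E` is the region strictly above it. -/
def HasC1Boundary (E : Set Plane) : Prop :=
  ∀ x ∈ frontier E, ∃ (A : Plane ≃ₗᵢ[ℝ] Plane) (f : ℝ → ℝ) (r : ℝ),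
    ContDiff ℝ 1 f ∧ 0 < r ∧ ∀ y ∈ Metric.ball x r,
      (y ∈ frontier E ↔ (A y) 1 = f ((A y) 0)) ∧
      (y ∈ interior E ↔ f ((A y) 0) < (A y) 1)

end

/-! A convex body fails to be `C¹` only at a corner, a boundary point `x₀` with two distinct
supporting lines, and a corner costs infinite energy. Let `x` be a boundary point at distance `d >
0` from `x₀`. Averaging the integrand over the reflection `y ↦ 2x - y` makes it nonnegative almost
everywhere, since `y` and `2x - y` cannot both be interior to `E`. The two supporting lines leave
room for a ball of radius `d`, at distance comparable to `d` from `x`, that misses `E` together with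
its reflection. It contributes a multiple of `d ^ 2 / d ^ (2 + s)`, so the curvature is at least `c
* d ^ (-s)` (`le_truncatedCurvature`, `exists_mul_dist_rpow_le_of_corner`). The boundary meets every
small circle about `x₀`, and the distance to `x₀` is 1-Lipschitz, so the energy dominates the
integral of `c ^ p * t ^ (-(s * p))` near `0`, which diverges as `s * p ≥ 1`. Without corners, the
convex function whose graph is locally the boundary has a single subgradient at each point, hence is
`C¹`. -/

/-! ### Truncated curvature of a convex set -/

/-- The kernel of the nonlocal mean curvature is integrable away from its singularity. -/
theorem integrableOn_kernel_compl_ball {s : ℝ} (hs : 0 < s) (x : Plane) {ε : ℝ} (hε : 0 < ε) :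
    IntegrableOn (fun y : Plane => (‖x - y‖ ^ (2 + s))⁻¹) (Metric.ball x ε)ᶜ := by
  have h1 : Integrable (fun y : Plane => (1 + ‖x - y‖) ^ (-(2 + s))) := by
    have := integrable_one_add_norm (E := Plane) (μ := volume) (r := 2 + s) (by simp; linarith)
    exact this.comp_sub_left x
  have h2 := (h1.const_mul ((1 + 1 / ε) ^ (2 + s))).integrableOn (s := (Metric.ball x ε)ᶜ)
  refine h2.mono' ?_ ?_
  · exact Measurable.aestronglyMeasurable (by fun_prop)
  · refine (ae_restrict_iff' Metric.isOpen_ball.measurableSet.compl).2 (ae_of_all _ fun y hy => ?_)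
    have hy' : ε ≤ ‖x - y‖ := by
      simpa [dist_eq_norm, norm_sub_rev] using hy
    have hpos : 0 < ‖x - y‖ := hε.trans_le hy'
    have hle : 1 + ‖x - y‖ ≤ (1 + 1 / ε) * ‖x - y‖ := by
      have : 1 ≤ 1 / ε * ‖x - y‖ := by
        rw [one_div, inv_mul_eq_div, one_le_div hε]; exact hy'
      linarith
    have hp : 0 < (1 + ‖x - y‖) ^ (2 + s) := by positivity
    rw [Real.norm_of_nonneg (by positivity), Real.rpow_neg (by positivity), ← div_eq_mul_inv,
      inv_eq_one_div, div_le_div_iff₀ (by positivity) hp, one_mul,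
      ← Real.mul_rpow (by positivity) (by positivity)]
    exact Real.rpow_le_rpow (by positivity) hle (by linarith)

theorem integrableOn_truncatedCurvature_integrand {s : ℝ} (hs : 0 < s) {E : Set Plane}
    (hE : NullMeasurableSet E) (x : Plane) {ε : ℝ} (hε : 0 < ε) :
    IntegrableOn (fun y : Plane =>
      (Eᶜ.indicator (fun _ => (1 : ℝ)) y - E.indicator (fun _ => (1 : ℝ)) y) / ‖x - y‖ ^ (2 + s))
      (Metric.ball x ε)ᶜ := by
  refine (integrableOn_kernel_compl_ball hs x hε).mono' ?_ (ae_of_all _ fun y => ?_)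
  · have h1 : AEMeasurable (Eᶜ.indicator (fun _ => (1 : ℝ))) (volume : Measure Plane) :=
      aemeasurable_const.indicator₀ hE.compl
    have h2 : AEMeasurable (E.indicator (fun _ => (1 : ℝ))) (volume : Measure Plane) :=
      aemeasurable_const.indicator₀ hE
    exact ((h1.sub h2).div (by fun_prop)).aestronglyMeasurable.restrict
  · by_cases hy : y ∈ E <;> simp [hy, abs_of_nonneg (Real.rpow_nonneg (norm_nonneg (x - y)) _)]

/-- If a ball and its reflection in a boundary point `x` of a convex set miss the set, then the
truncated curvature at `x` is at least the integral of the kernel over that ball. -/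
theorem le_truncatedCurvature {s : ℝ} (hs : 0 < s) {E : Set Plane} (hE : Convex ℝ E) {x : Plane}
    (hx : x ∈ frontier E) {h : Plane} {d ε : ℝ} (hε : 0 < ε) (hεd : ε ≤ d) (hh : 2 * d ≤ ‖h‖)
    (hball : ∀ k ∈ Metric.ball h d, x + k ∉ E ∧ x - k ∉ E) :
    volume.real (Metric.ball (0 : Plane) 1) * d ^ 2 / (2 * ‖h‖) ^ (2 + s) ≤
      truncatedCurvature s E x ε := by
  have hd : 0 < d := hε.trans_le hεd
  have hnull := hE.nullMeasurableSet (volume : Measure Plane)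
  set g : Plane → ℝ := fun y =>
    (Eᶜ.indicator (fun _ => (1 : ℝ)) y - E.indicator (fun _ => (1 : ℝ)) y) / ‖x - y‖ ^ (2 + s)
    with hg
  set S : Set Plane := (Metric.ball x ε)ᶜ with hS
  have hSm : MeasurableSet S := Metric.isOpen_ball.measurableSet.compl
  have hGi : Integrable (S.indicator g) :=
    (integrableOn_truncatedCurvature_integrand hs hnull x hε).integrable_indicator hSm
  have hGi' : Integrable (fun y => S.indicator g (x + x - y)) := hGi.comp_sub_left (x + x)
  have hT : truncatedCurvature s E x ε = ∫ y, S.indicator g y :=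
    (integral_indicator hSm).symm
  have hT' : ∫ y, S.indicator g (x + x - y) = ∫ y, S.indicator g y :=
    integral_sub_left_eq_self (S.indicator g) volume (x + x)
  -- Reflection in `x` preserves Lebesgue measure, the kernel and the truncated domain.
  have hsum : truncatedCurvature s E x ε =
      ∫ y, (S.indicator g y + S.indicator g (x + x - y)) / 2 := by
    rw [integral_div, integral_add hGi hGi', hT', hT]; ring
  have hvol : volume.real (Metric.ball (x + h) d) =
      volume.real (Metric.ball (0 : Plane) 1) * d ^ 2 := by
    rw [measureReal_def, Measure.addHaar_ball _ _ hd.le, ENNReal.toReal_mul,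
      ENNReal.toReal_ofReal (by positivity), measureReal_def]
    simp [mul_comm]
  have hind : ∫ y, (Metric.ball (x + h) d).indicator (fun _ => ((2 * ‖h‖) ^ (2 + s))⁻¹) y =
      volume.real (Metric.ball (0 : Plane) 1) * d ^ 2 / (2 * ‖h‖) ^ (2 + s) := by
    rw [integral_indicator Metric.isOpen_ball.measurableSet, setIntegral_const, hvol, smul_eq_mul,
      div_eq_mul_inv]
  rw [← hind, hsum]
  refine integral_mono_ae ?_ ((hGi.add hGi').div_const 2) ?_
  · exact (integrable_indicator_iff Metric.isOpen_ball.measurableSet).2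
      (integrableOn_const (by exact measure_ball_lt_top.ne))
  -- Off this null set, `y ∈ E` means `y` is interior; were `2x - y` in `E` too, the midpoint `x`
  -- would be interior.
  have hfr : ∀ᵐ y ∂(volume : Measure Plane), y ∉ frontier E :=
    measure_eq_zero_iff_ae_notMem.1 (hE.addHaar_frontier volume)
  filter_upwards [hfr] with y hy
  have hrefl : x - (x + x - y) = -(x - y) := by abel
  have hSy : x + x - y ∈ S ↔ y ∈ S := by
    simp only [hS, Set.mem_compl_iff, Metric.mem_ball, dist_eq_norm, not_lt]
    rw [show x + x - y - x = x - y by abel, norm_sub_rev]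
  have hgg : g (x + x - y) =
      (Eᶜ.indicator (fun _ => (1 : ℝ)) (x + x - y) - E.indicator (fun _ => (1 : ℝ)) (x + x - y)) /
        ‖x - y‖ ^ (2 + s) := by
    simp only [hg, hrefl, norm_neg]
  by_cases hyB : y ∈ Metric.ball (x + h) d
  · have hk : y - x ∈ Metric.ball h d := by
      rw [Metric.mem_ball, dist_eq_norm] at hyB ⊢
      rwa [show y - x - h = y - (x + h) by abel]
    obtain ⟨h1, h2⟩ := hball _ hk
    rw [show x + (y - x) = y by abel] at h1
    rw [show x - (y - x) = x + x - y by abel] at h2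
    rw [Metric.mem_ball, dist_eq_norm] at hk
    have hlow : d ≤ ‖x - y‖ := by
      have := norm_sub_norm_le h (y - x)
      rw [norm_sub_rev h] at this
      rw [norm_sub_rev]; linarith
    have hup : ‖x - y‖ ≤ 2 * ‖h‖ := by
      have := norm_sub_norm_le (y - x) h
      rw [norm_sub_rev]; linarith
    have hyS : y ∈ S := by
      simp only [hS, Set.mem_compl_iff, Metric.mem_ball, dist_eq_norm, not_lt, norm_sub_rev y x]
      linarith
    have hpos : 0 < ‖x - y‖ ^ (2 + s) := Real.rpow_pos_of_pos (hd.trans_le hlow) _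
    rw [Set.indicator_of_mem hyB, Set.indicator_of_mem hyS, Set.indicator_of_mem (hSy.2 hyS), hgg]
    simp only [hg]
    simp only [Set.mem_compl_iff, h1, h2, not_false_eq_true, Set.indicator_of_mem,
      Set.indicator_of_notMem, sub_zero]
    rw [add_self_div_two, one_div]
    exact inv_anti₀ hpos (Real.rpow_le_rpow (norm_nonneg _) hup (by linarith))
  · rw [Set.indicator_of_notMem hyB]
    by_cases hyS : y ∈ S
    · rw [Set.indicator_of_mem hyS, Set.indicator_of_mem (hSy.2 hyS), hgg]
      have hnot : ¬ (y ∈ E ∧ x + x - y ∈ E) := by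
        rintro ⟨h1, h2⟩
        have hyi : y ∈ interior E := by
          by_contra hc
          exact hy ⟨subset_closure h1, hc⟩
        refine hx.2 (hE.openSegment_interior_closure_subset_interior hyi (subset_closure h2)
          ⟨1 / 2, 1 / 2, by norm_num, by norm_num, by norm_num, ?_⟩)
        module
      have hnn : 0 ≤ ‖x - y‖ ^ (2 + s) := Real.rpow_nonneg (norm_nonneg _) _
      simp only [hg]
      rw [← add_div]
      refine div_nonneg (div_nonneg ?_ hnn) zero_le_two
      by_cases h1 : y ∈ E <;> by_cases h2 : x + x - y ∈ E <;> simp [h1, h2]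
      exact (hnot ⟨h1, h2⟩).elim
    · rw [Set.indicator_of_notMem hyS, Set.indicator_of_notMem (fun h => hyS (hSy.1 h))]
      simp

/-! ### Divergence of the energy at a corner -/

/-- The distance to a point does not increase one-dimensional Hausdorff measure. -/
theorem volume_restrict_le_map_dist_hausdorffMeasure {F : Set Plane}
    (x : Plane) {T : Set ℝ} (hT : T ⊆ (fun y => dist y x) '' F) :
    (volume : Measure ℝ).restrict T ≤
      ((Measure.hausdorffMeasure 1 : Measure Plane).restrict F).map (fun y => dist y x) := by
  have hm : Measurable (fun y : Plane => dist y x) := by fun_prop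
  refine Measure.le_iff.2 fun B hB => ?_
  rw [Measure.map_apply hm hB, Measure.restrict_apply hB, Measure.restrict_apply (hm hB)]
  have hlip : LipschitzWith 1 (fun y : Plane => dist y x) := LipschitzWith.dist_left x
  have := hlip.hausdorffMeasure_image_le (d := 1) zero_le_one ((fun y => dist y x) ⁻¹' B ∩ F)
  rw [hausdorffMeasure_real] at this
  simp only [ENNReal.coe_one, ENNReal.one_rpow, one_mul] at this
  refine le_trans (measure_mono ?_) this
  rintro t ⟨htB, htT⟩
  obtain ⟨y, hy, rfl⟩ := hT htT
  exact ⟨y, ⟨htB, hy⟩, rfl⟩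

theorem lintegral_Ioo_rpow_neg_eq_top {q R c : ℝ} (hq : 1 ≤ q) (hR : 0 < R) (hc : 0 < c) :
    ∫⁻ t in Set.Ioo 0 R, ENNReal.ofReal (c * t ^ (-q)) = ∞ := by
  by_contra hne
  have hint : IntegrableOn (fun t : ℝ => c * t ^ (-q)) (Set.Ioo 0 R) := by
    refine ⟨Measurable.aestronglyMeasurable (by fun_prop), ?_⟩
    rw [hasFiniteIntegral_iff_ofReal]
    · exact lt_top_iff_ne_top.2 hne
    · refine (ae_restrict_iff' measurableSet_Ioo).2 (ae_of_all _ fun t ht => ?_)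
      exact mul_nonneg hc.le (Real.rpow_nonneg ht.1.le _)
  have h2 : IntegrableOn (fun t : ℝ => t ^ (-q)) (Set.Ioo 0 R) := by
    have := hint.const_mul c⁻¹
    simpa only [IntegrableOn, ← mul_assoc, inv_mul_cancel₀ hc.ne', one_mul] using this
  rw [intervalIntegral.integrableOn_Ioo_rpow_iff hR] at h2
  linarith

/-- Near a point with two distinct supporting lines, spheres around the point meet the frontier. -/
theorem exists_mem_frontier_dist_eq {E : Set Plane} (hE : Convex ℝ E) {x₀ z : Plane}
    (hx₀ : x₀ ∈ frontier E) (hz : z ∈ interior E) {L : Plane →L[ℝ] ℝ} {v : Plane}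
    (hL : ∀ y ∈ E, L (y - x₀) ≤ 0) (hv : 0 < L v) {r : ℝ} (hr : 0 < r) (hrz : r < dist z x₀) :
    ∃ y ∈ frontier E, dist y x₀ = r := by
  by_contra! hne
  have hv0 : 0 < ‖v‖ := norm_pos_iff.2 fun h => by simp [h] at hv
  have hz0 : 0 < ‖z - x₀‖ := by rw [← dist_eq_norm]; exact hr.trans hrz
  have hLc : ∀ y ∈ closure E, L (y - x₀) ≤ 0 := by
    have hcl : IsClosed {y | L (y - x₀) ≤ 0} :=
      isClosed_le (by fun_prop) continuous_const
    exact fun y hy => closure_minimal (fun y hy => hL y hy) hcl hy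
  have hconn : IsPreconnected (Metric.sphere x₀ r) :=
    isPreconnected_sphere (by rw [← Module.finrank_eq_rank]; simp) x₀ r
  suffices h : (Metric.sphere x₀ r ∩ (interior E ∩ (closure E)ᶜ)).Nonempty by
    obtain ⟨y, -, hy1, hy2⟩ := h
    exact hy2 (interior_subset_closure hy1)
  refine hconn (interior E) (closure E)ᶜ isOpen_interior isClosed_closure.isOpen_compl
    (fun y hy => ?_) ?_ ?_
  · by_cases hyi : y ∈ interior E
    · exact Or.inl hyi
    · exact Or.inr fun hyc => hne y ⟨hyc, hyi⟩ hy
  · have hmem : x₀ + (r / ‖z - x₀‖) • (z - x₀) ∈ interior E := by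
      have := hE.add_smul_sub_mem_interior' hx₀.1 hz (t := r / ‖z - x₀‖)
        ⟨by positivity, by rw [div_le_one hz0, ← dist_eq_norm]; exact hrz.le⟩
      simpa using this
    refine ⟨_, ?_, hmem⟩
    rw [mem_sphere_iff_norm, add_sub_cancel_left, norm_smul, Real.norm_of_nonneg (by positivity),
      div_mul_cancel₀ _ hz0.ne']
  · refine ⟨x₀ + (r / ‖v‖) • v, ?_, fun hc => ?_⟩
    · rw [mem_sphere_iff_norm, add_sub_cancel_left, norm_smul, Real.norm_of_nonneg (by positivity),
        div_mul_cancel₀ _ hv0.ne']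
    · have := hLc _ hc
      rw [add_sub_cancel_left, map_smul, smul_eq_mul] at this
      have : 0 < r / ‖v‖ * L v := by positivity
      linarith

/-- At a corner the nonlocal mean curvature blows up at least like `dist · x₀ ^ (-s)`. -/
theorem exists_mul_dist_rpow_le_of_corner {s : ℝ} (hs : 0 < s) {E : Set Plane} (hE : Convex ℝ E)
    {x₀ : Plane} {L₁ L₂ : Plane →L[ℝ] ℝ} {v : Plane}
    (hL₁ : ∀ y ∈ E, L₁ (y - x₀) ≤ 0) (hL₂ : ∀ y ∈ E, L₂ (y - x₀) ≤ 0)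
    (hv₁ : 0 < L₁ v) (hv₂ : L₂ v < 0) :
    ∃ c > 0, ∀ x ∈ frontier E, x ≠ x₀ → ∀ H, HasNonlocalMeanCurvature s E x H →
      c * dist x x₀ ^ (-s) ≤ H := by
  obtain ⟨M, hM, hM₁, hM₂⟩ : ∃ M > 0, ‖L₁‖ ≤ M ∧ ‖L₂‖ ≤ M :=
    ⟨‖L₁‖ + ‖L₂‖ + 1, by positivity, by linarith [norm_nonneg L₂], by linarith [norm_nonneg L₁]⟩
  -- The size `2 * M` absorbs two errors of at most `d * M` each: the displacement `x - x₀` and the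
  -- radius of the ball.
  obtain ⟨w, hw₁, hw₂⟩ : ∃ w : Plane, 2 * M ≤ L₁ w ∧ L₂ w ≤ - (2 * M) := by
    refine ⟨(2 * M / L₁ v + 2 * M / (- L₂ v)) • v, ?_, ?_⟩
    · have h : 0 < 2 * M / (- L₂ v) := by have := neg_pos.2 hv₂; positivity
      rw [map_smul, smul_eq_mul, add_mul, div_mul_cancel₀ _ hv₁.ne']
      have := mul_pos h hv₁
      linarith
    · have h : 0 < 2 * M / L₁ v := by positivity
      have h' : 2 * M / (- L₂ v) * L₂ v = - (2 * M) := by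
        field_simp [hv₂.ne]
      rw [map_smul, smul_eq_mul, add_mul, h']
      have := mul_neg_of_pos_of_neg h hv₂
      linarith
  have hw : 2 ≤ ‖w‖ := by
    have h := (Real.le_norm_self _).trans (L₁.le_of_opNorm_le hM₁ w)
    nlinarith
  refine ⟨volume.real (Metric.ball (0 : Plane) 1) / (2 * ‖w‖) ^ (2 + s), ?_, ?_⟩
  · refine div_pos ?_ (by positivity)
    exact ENNReal.toReal_pos (Metric.measure_ball_pos _ _ one_pos).ne' measure_ball_lt_top.ne
  intro x hx hne H hH
  set d := dist x x₀ with hd_def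
  have hd : 0 < d := dist_pos.2 hne
  have hnorm : ‖d • w‖ = d * ‖w‖ := by rw [norm_smul, Real.norm_of_nonneg hd.le]
  have key : ∀ (L : Plane →L[ℝ] ℝ), ‖L‖ ≤ M → ∀ k ∈ Metric.ball (d • w) d,
      |L (k - d • w)| < d * M ∧ |L (x - x₀)| ≤ d * M := by
    intro L hLM k hk
    rw [Metric.mem_ball, dist_eq_norm] at hk
    refine ⟨?_, ?_⟩
    · have := L.le_of_opNorm_le hLM (k - d • w)
      rw [Real.norm_eq_abs] at this
      nlinarith
    · have := L.le_of_opNorm_le hLM (x - x₀)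
      rw [Real.norm_eq_abs, ← dist_eq_norm] at this
      linarith
  have hball : ∀ k ∈ Metric.ball (d • w) d, x + k ∉ E ∧ x - k ∉ E := by
    intro k hk
    constructor
    · intro hmem
      have h0 := hL₁ _ hmem
      obtain ⟨h1, h2⟩ := key L₁ hM₁ k hk
      rw [show x + k - x₀ = (x - x₀) + (k - d • w) + d • w by abel, map_add, map_add, map_smul,
        smul_eq_mul] at h0
      have := mul_le_mul_of_nonneg_left hw₁ hd.le
      linarith [(abs_lt.1 h1).1, (abs_le.1 h2).1]
    · intro hmem
      have h0 := hL₂ _ hmem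
      obtain ⟨h1, h2⟩ := key L₂ hM₂ k hk
      rw [show x - k - x₀ = (x - x₀) - (k - d • w) - d • w by abel, map_sub, map_sub, map_smul,
        smul_eq_mul] at h0
      have := mul_le_mul_of_nonneg_left hw₂ hd.le
      linarith [(abs_lt.1 h1).2, (abs_le.1 h2).1]
  have heq : volume.real (Metric.ball (0 : Plane) 1) / (2 * ‖w‖) ^ (2 + s) * d ^ (-s) =
      volume.real (Metric.ball (0 : Plane) 1) * d ^ 2 / (2 * ‖d • w‖) ^ (2 + s) := by
    rw [hnorm, show 2 * (d * ‖w‖) = d * (2 * ‖w‖) by ring, Real.mul_rpow hd.le (by positivity),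
      Real.rpow_add hd, Real.rpow_neg hd.le, Real.rpow_two]
    have : 0 < d ^ s := by positivity
    field_simp
  rw [heq]
  refine ge_of_tendsto hH ?_
  filter_upwards [Ioc_mem_nhdsGT hd] with ε hε
  exact le_truncatedCurvature hs hE hx hε.1 hε.2 (by rw [hnorm]; nlinarith) hball

/-- A convex set of finite nonlocal Willmore energy has no corners. -/
theorem not_corner_of_nonlocalWillmoreEnergy_lt_top {s p : ℝ} (hs : 0 < s) (hp : 1 / s ≤ p)
    {E : Set Plane} (hE : Convex ℝ E) (hint : (interior E).Nonempty)
    (hfin : nonlocalWillmoreEnergy s p E < ∞) {x₀ : Plane} (hx₀ : x₀ ∈ frontier E)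
    {L₁ L₂ : Plane →L[ℝ] ℝ} {v : Plane}
    (hL₁ : ∀ y ∈ E, L₁ (y - x₀) ≤ 0) (hL₂ : ∀ y ∈ E, L₂ (y - x₀) ≤ 0)
    (hv₁ : 0 < L₁ v) : 0 ≤ L₂ v := by
  by_contra! hv₂
  obtain ⟨c, hc, hcH⟩ := exists_mul_dist_rpow_le_of_corner hs hE hL₁ hL₂ hv₁ hv₂
  obtain ⟨z, hz⟩ := hint
  have hR : 0 < dist z x₀ := dist_pos.2 fun h => hx₀.2 (h ▸ hz)
  have hp0 : 0 < p := (one_div_pos.2 hs).trans_le hp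
  rw [nonlocalWillmoreEnergy] at hfin
  split_ifs at hfin with hcond
  · have hT : Set.Ioo 0 (dist z x₀) ⊆ (fun y => dist y x₀) '' frontier E := fun r hr => by
      obtain ⟨y, hy, hyr⟩ := exists_mem_frontier_dist_eq hE hx₀ hz hL₁ hv₁ hr.1 hr.2
      exact ⟨y, hy, hyr⟩
    have hq : 1 ≤ s * p := by rwa [div_le_iff₀' hs] at hp
    refine hfin.not_ge ?_
    rw [← lintegral_Ioo_rpow_neg_eq_top hq hR (Real.rpow_pos_of_pos hc p)]
    refine (lintegral_mono' (volume_restrict_le_map_dist_hausdorffMeasure x₀ hT) le_rfl).trans ?_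
    rw [lintegral_map (by fun_prop) (by fun_prop)]
    refine lintegral_mono_ae ?_
    filter_upwards [hcond.2, ae_restrict_mem isClosed_frontier.measurableSet] with x hx hxF
    obtain ⟨H, hH⟩ := hx
    rw [hH.eq]
    refine ENNReal.ofReal_le_ofReal ?_
    rcases eq_or_ne x x₀ with rfl | hne
    -- At the corner itself `0 ^ (-(s * p))` is `0` by convention, so no curvature bound is needed.
    · rw [dist_self, Real.zero_rpow (by linarith), mul_zero]
      positivity
    · have hd : 0 < dist x x₀ := dist_pos.2 hne
      have hle := hcH x hxF hne H hH
      rw [← neg_mul, Real.rpow_mul hd.le, ← Real.mul_rpow hc.le (by positivity)]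
      exact Real.rpow_le_rpow (by positivity) (hle.trans (le_abs_self H)) hp0.le
  · exact lt_irrefl _ hfin

/-! ### Convex functions of one variable -/

/-- The derivative of a convex function that is differentiable on an open set is continuous. -/
theorem ConvexOn.continuousOn_deriv {J : Set ℝ} {f : ℝ → ℝ} (hJ : IsOpen J) (hf : ConvexOn ℝ J f)
    (hd : ∀ t ∈ J, DifferentiableAt ℝ f t) : ContinuousOn (deriv f) J := by
  intro t ht
  have hslope (y : ℝ) (hy : y ≠ t) : ContinuousAt (fun x => slope f x y) t := by
    simp only [slope_def_field]
    exact (continuousAt_const.sub (hd t ht).continuousAt).div (by fun_prop) (sub_ne_zero.2 hy)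
  have hlim := hasDerivAt_iff_tendsto_slope.1 (hd t ht).hasDerivAt
  -- Fix `y` on one side of `t` with the slope from `t` to `y` close to `f' t`. The slope from `x`
  -- to `y` is continuous in `x` and bounds `f' x`, from below if `y < t` and from above if `y > t`.
  refine ContinuousAt.continuousWithinAt (tendsto_order.2 ⟨fun b hb => ?_, fun b hb => ?_⟩)
  · have h1 : ∀ᶠ y in 𝓝[<] t, b < slope f t y :=
      (hlim.mono_left (nhdsWithin_mono t fun y hy => ne_of_lt hy)).eventually_const_lt hb
    have h2 : ∀ᶠ y in 𝓝[<] t, y ∈ J := nhdsWithin_le_nhds (hJ.mem_nhds ht)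
    obtain ⟨y, ⟨hyb, hyJ⟩, hyt⟩ := ((h1.and h2).and self_mem_nhdsWithin).exists
    rw [slope_comm, slope_comm] at hyb
    filter_upwards [(hslope y (ne_of_lt hyt)).eventually_const_lt hyb, hJ.mem_nhds ht,
      lt_mem_nhds (show y < t from hyt)] with x hx hxJ hyx
    rw [slope_comm] at hx
    exact hx.trans_le (hf.slope_le_deriv hyJ hxJ hyx (hd x hxJ))
  · have h1 : ∀ᶠ y in 𝓝[>] t, slope f t y < b :=
      (hlim.mono_left (nhdsWithin_mono t fun y hy => ne_of_gt hy)).eventually_lt_const hb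
    have h2 : ∀ᶠ y in 𝓝[>] t, y ∈ J := nhdsWithin_le_nhds (hJ.mem_nhds ht)
    obtain ⟨y, ⟨hyb, hyJ⟩, hyt⟩ := ((h1.and h2).and self_mem_nhdsWithin).exists
    filter_upwards [(hslope y (ne_of_gt hyt)).eventually_lt_const hyb, hJ.mem_nhds ht,
      gt_mem_nhds (show t < y from hyt)] with x hx hxJ hxy
    exact (hf.deriv_le_slope hxJ hyJ hxy (hd x hxJ)).trans_lt hx

/-- A convex function lies above every line through one of its points whose slope lies between
the one-sided derivatives. -/
theorem ConvexOn.add_mul_sub_le {J : Set ℝ} {f : ℝ → ℝ} (hJ : IsOpen J) (hf : ConvexOn ℝ J f)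
    {t x m : ℝ} (ht : t ∈ J) (hx : x ∈ J) (hm₁ : derivWithin f (Set.Iio t) t ≤ m)
    (hm₂ : m ≤ derivWithin f (Set.Ioi t) t) : f t + m * (x - t) ≤ f x := by
  have ht' : t ∈ interior J := by rwa [hJ.interior_eq]
  rcases lt_trichotomy x t with h | rfl | h
  · have := (hf.slope_le_leftDeriv_of_mem_interior hx ht' h).trans hm₁
    rw [slope_def_field, div_le_iff₀ (sub_pos.2 h)] at this
    linarith
  · simp
  · have := hm₂.trans (hf.rightDeriv_le_slope_of_mem_interior ht' hx h)
    rw [slope_def_field, le_div_iff₀ (sub_pos.2 h)] at this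
    linarith

/-- A convex function on an open set with at most one subgradient at each point is `C¹`. -/
theorem ConvexOn.contDiffOn_one_of_subgradient_le {J : Set ℝ} {f : ℝ → ℝ} (hJ : IsOpen J)
    (hf : ConvexOn ℝ J f)
    (huniq : ∀ t ∈ J, ∀ m₁ m₂ : ℝ, (∀ x ∈ J, f t + m₁ * (x - t) ≤ f x) →
      (∀ x ∈ J, f t + m₂ * (x - t) ≤ f x) → m₁ ≤ m₂) : ContDiffOn ℝ 1 f J := by
  have hd : ∀ t ∈ J, DifferentiableAt ℝ f t := by
    intro t ht
    have ht' : t ∈ interior J := by rwa [hJ.interior_eq]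
    have hlr := hf.leftDeriv_le_rightDeriv_of_mem_interior ht'
    have heq := hlr.antisymm (huniq t ht _ _ (fun x hx => hf.add_mul_sub_le hJ ht hx hlr le_rfl)
      (fun x hx => hf.add_mul_sub_le hJ ht hx le_rfl hlr))
    have hl := hf.hasDerivWithinAt_leftDeriv_of_mem_interior ht'
    have hr := hf.hasDerivWithinAt_rightDeriv_of_mem_interior ht'
    rw [heq] at hl
    have h := hl.union hr.Ici_of_Ioi
    rw [Set.Iio_union_Ici, hasDerivWithinAt_univ] at h
    exact h.differentiableAt
  have := (contDiffOn_succ_iff_deriv_of_isOpen (𝕜 := ℝ) (n := 0) (f := f) hJ).2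
    ⟨fun t ht => (hd t ht).differentiableWithinAt, by simp,
      contDiffOn_zero.2 (hf.continuousOn_deriv hJ hd)⟩
  simpa using this

/-- A `C¹` function on an open set agrees near each point with a globally `C¹` function. -/
theorem ContDiffOn.exists_contDiff_eqOn_ball {J : Set ℝ} {f : ℝ → ℝ} (hJ : IsOpen J)
    (hf : ContDiffOn ℝ 1 f J) {t : ℝ} (ht : t ∈ J) :
    ∃ g : ℝ → ℝ, ContDiff ℝ 1 g ∧ ∃ δ > 0, ∀ x ∈ Metric.ball t δ, g x = f x := by
  obtain ⟨δ, hδ, hδJ⟩ := Metric.isOpen_iff.1 hJ t ht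
  let φ : ContDiffBump t := ⟨δ / 4, δ / 2, by positivity, by linarith⟩
  refine ⟨fun x => φ x * f x, ?_, δ / 4, by positivity, fun x hx => ?_⟩
  · refine contDiff_iff_contDiffAt.2 fun x => ?_
    by_cases hx : x ∈ J
    · exact φ.contDiffAt.mul (hf.contDiffAt (hJ.mem_nhds hx))
    · have hx' : x ∉ tsupport φ := fun h => hx (hδJ (by
        rw [φ.tsupport_eq] at h
        exact Metric.closedBall_subset_ball (by simp only [φ]; linarith) h))
      refine (contDiffAt_const (c := (0 : ℝ))).congr_of_eventuallyEq ?_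
      filter_upwards [notMem_tsupport_iff_eventuallyEq.1 hx'] with y hy
      simp [hy]
  · beta_reduce
    rw [φ.one_of_mem_closedBall (Metric.ball_subset_closedBall hx), one_mul]

/-! ### Lower boundary of an open convex region -/

/-- The function whose graph bounds a planar region from below. -/
noncomputable def lowerBoundary (U : Set (ℝ × ℝ)) (t : ℝ) : ℝ := sInf {u | (t, u) ∈ U}

section LowerBoundary

variable {U : Set (ℝ × ℝ)} {b : ℝ}

theorem lowerBoundary_lt (hU : IsOpen U) (hb : ∀ q ∈ U, b ≤ q.2) {t u : ℝ} (h : (t, u) ∈ U) :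
    lowerBoundary U t < u := by
  have hopen : IsOpen {u | (t, u) ∈ U} := hU.preimage (by fun_prop)
  obtain ⟨l, hl, hlu⟩ := exists_Ioc_subset_of_mem_nhds (hopen.mem_nhds h) ⟨u - 1, by linarith⟩
  have hmem : (l + u) / 2 ∈ {u | (t, u) ∈ U} := hlu ⟨by linarith, by linarith⟩
  have hle : lowerBoundary U t ≤ (l + u) / 2 := csInf_le ⟨b, fun v hv => hb _ hv⟩ hmem
  linarith

theorem exists_mem_lt_of_lowerBoundary_lt {t u : ℝ} (ht : t ∈ Prod.fst '' U)
    (h : lowerBoundary U t < u) : ∃ v < u, (t, v) ∈ U := by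
  obtain ⟨⟨t, w⟩, hw, rfl⟩ := ht
  obtain ⟨v, hv, hvu⟩ := exists_lt_of_csInf_lt (s := {u | (t, u) ∈ U}) ⟨w, hw⟩ h
  exact ⟨v, hvu, hv⟩

theorem mem_of_lowerBoundary_lt (hc : Convex ℝ U) {t u w : ℝ} (hw : (t, w) ∈ U) (huw : u ≤ w)
    (h : lowerBoundary U t < u) : (t, u) ∈ U := by
  obtain ⟨v, hvu, hv⟩ := exists_mem_lt_of_lowerBoundary_lt ⟨_, hw, rfl⟩ h
  have hcv : Convex ℝ {u | (t, u) ∈ U} := by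
    intro x hx y hy α β hα hβ hαβ
    have := hc hx hy hα hβ hαβ
    simpa [← add_mul, hαβ] using this
  exact hcv.ordConnected.out hv hw ⟨hvu.le, huw⟩

/-- The infimum is not attained, since `U` is open, so points of `U` within `ε` of it are combined
instead. -/
theorem convexOn_lowerBoundary (hU : IsOpen U) (hc : Convex ℝ U) (hb : ∀ q ∈ U, b ≤ q.2) :
    ConvexOn ℝ (Prod.fst '' U) (lowerBoundary U) := by
  refine ⟨hc.linear_image (LinearMap.fst ℝ ℝ ℝ), fun x hx y hy α β hα hβ hαβ => ?_⟩
  refine le_of_forall_pos_le_add fun ε hε => ?_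
  obtain ⟨v, hv, hvU⟩ := exists_mem_lt_of_lowerBoundary_lt hx (lt_add_of_pos_right _ hε)
  obtain ⟨w, hw, hwU⟩ := exists_mem_lt_of_lowerBoundary_lt hy (lt_add_of_pos_right _ hε)
  have h := (lowerBoundary_lt hU hb (hc hvU hwU hα hβ hαβ)).le
  have h1 := mul_le_mul_of_nonneg_left hv.le hα
  have h2 := mul_le_mul_of_nonneg_left hw.le hβ
  have h3 : α * ε + β * ε = ε := by rw [← add_mul, hαβ, one_mul]
  simp only [Prod.smul_mk, smul_eq_mul] at h ⊢
  linarith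

theorem mk_lowerBoundary_mem_closure (hb : ∀ q ∈ U, b ≤ q.2) {t : ℝ} (ht : t ∈ Prod.fst '' U) :
    (t, lowerBoundary U t) ∈ closure U := by
  obtain ⟨⟨t, w⟩, hw, rfl⟩ := ht
  have h : lowerBoundary U t ∈ closure {u | (t, u) ∈ U} :=
    csInf_mem_closure ⟨w, hw⟩ ⟨b, fun v hv => hb _ hv⟩
  exact map_mem_closure (f := fun u => (t, u)) (by fun_prop) h fun u hu => hu

/-- Near a vertical line that meets the region, the frontier is the graph of the lower boundary
and the region is what lies strictly above it. -/
theorem mem_frontier_and_mem_iff_of_lowerBoundary (hU : IsOpen U) (hc : Convex ℝ U)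
    (hb : ∀ q ∈ U, b ≤ q.2) {t u w : ℝ} (hw : (t, w) ∈ U) (huw : u ≤ w) :
    ((t, u) ∈ frontier U ↔ u = lowerBoundary U t) ∧ ((t, u) ∈ U ↔ lowerBoundary U t < u) := by
  have hiff : (t, u) ∈ U ↔ lowerBoundary U t < u :=
    ⟨lowerBoundary_lt hU hb, mem_of_lowerBoundary_lt hc hw huw⟩
  refine ⟨⟨fun h => ?_, fun h => ?_⟩, hiff⟩
  -- A point strictly below the graph has a neighbourhood below it, by continuity of the convex
  -- lower boundary, so it is not in the closure.
  · rw [hU.frontier_eq, Set.mem_sdiff, hiff, not_lt] at h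
    refine h.2.antisymm (not_lt.1 fun hlt => ?_)
    have hJ : IsOpen (Prod.fst '' U) := isOpenMap_fst U hU
    have hcont : ContinuousAt (fun q : ℝ × ℝ => lowerBoundary U q.1) (t, u) :=
      ((convexOn_lowerBoundary hU hc hb).continuousOn hJ |>.continuousAt
        (hJ.mem_nhds ⟨_, hw, rfl⟩)).comp_of_eq continuousAt_fst rfl
    have hev : ∀ᶠ q : ℝ × ℝ in 𝓝 (t, u), q.2 < lowerBoundary U q.1 :=
      continuousAt_snd.eventually_lt hcont hlt
    obtain ⟨q, hqU, hq⟩ := ((mem_closure_iff_frequently.1 h.1).and_eventually hev).exists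
    exact (lowerBoundary_lt hU hb (t := q.1) (u := q.2) hqU).not_gt hq
  · rw [hU.frontier_eq, Set.mem_sdiff, hiff, h]
    exact ⟨mk_lowerBoundary_mem_closure hb ⟨_, hw, rfl⟩, lt_irrefl _⟩

end LowerBoundary

/-! ### From graphs to the boundary in the plane -/

theorem Convex.frontier_interior_eq {E : Set Plane} (hE : Convex ℝ E)
    (hint : (interior E).Nonempty) : frontier (interior E) = frontier E := by
  rw [frontier, frontier, interior_interior,
    hE.closure_interior_eq_closure_of_nonempty_interior hint]

/-- Cartesian coordinates of the plane after an isometry. -/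
noncomputable def planeCoordinates (A : Plane ≃ₗᵢ[ℝ] Plane) : Plane ≃L[ℝ] ℝ × ℝ :=
  A.toContinuousLinearEquiv.trans
    ((EuclideanSpace.equiv (Fin 2) ℝ).trans (ContinuousLinearEquiv.finTwoArrow ℝ ℝ))

theorem exists_linearIsometryEquiv_apply_eq_smul {w : Plane} (hw : w ≠ 0) :
    ∃ A : Plane ≃ₗᵢ[ℝ] Plane, (A w) 0 = 0 ∧ (A w) 1 = ‖w‖ := by
  have hw' : ‖w‖ ≠ 0 := norm_ne_zero_iff.2 hw
  have hunit : ‖(‖w‖⁻¹ • w : Plane)‖ = 1 := by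
    rw [norm_smul, norm_inv, norm_norm, inv_mul_cancel₀ hw']
  obtain ⟨b, hb⟩ := Orthonormal.exists_orthonormalBasis_extension_of_card_eq (𝕜 := ℝ) (E := Plane)
    (ι := Fin 2) (by simp) (v := fun _ => ‖w‖⁻¹ • w) (s := {1})
    ⟨fun _ => hunit, fun i j hij => (hij (Subsingleton.elim i j)).elim⟩
  have hwb : w = ‖w‖ • b 1 := by
    rw [hb 1 rfl, smul_smul, mul_inv_cancel₀ hw', one_smul]
  have hrepr (i : Fin 2) : (b.repr w) i = ‖w‖ * (EuclideanSpace.single (1 : Fin 2) (1 : ℝ)) i := by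
    conv_lhs => rw [hwb]
    simp
  exact ⟨b.repr, by rw [hrepr]; simp, by rw [hrepr]; simp⟩

/-- A subgradient `m` of the lower boundary turns `(t, u) ↦ m * t - u` into a supporting functional
of `E`, so two different subgradients would make a corner. -/
theorem contDiffOn_lowerBoundary_of_not_corner {E : Set Plane} (hE : Convex ℝ E)
    (hint : (interior E).Nonempty)
    (hcorner : ∀ x₀ ∈ frontier E, ∀ (L₁ L₂ : Plane →L[ℝ] ℝ) (v : Plane),
      (∀ y ∈ E, L₁ (y - x₀) ≤ 0) → (∀ y ∈ E, L₂ (y - x₀) ≤ 0) → 0 < L₁ v → 0 ≤ L₂ v)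
    (e : Plane ≃L[ℝ] ℝ × ℝ) {b : ℝ} (hb : ∀ q ∈ e '' interior E, b ≤ q.2) :
    ContDiffOn ℝ 1 (lowerBoundary (e '' interior E)) (Prod.fst '' (e '' interior E)) := by
  set U := e '' interior E with hUdef
  have hU : IsOpen U := e.toHomeomorph.isOpenMap _ isOpen_interior
  have hc : Convex ℝ U := hE.interior.linear_image (e : Plane →ₗ[ℝ] ℝ × ℝ)
  refine (convexOn_lowerBoundary hU hc hb).contDiffOn_one_of_subgradient_le
    (isOpenMap_fst U hU) fun t ht m₁ m₂ h₁ h₂ => ?_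
  by_contra! hlt
  set q₀ : ℝ × ℝ := (t, lowerBoundary U t) with hq₀
  have hq₀f : e.symm q₀ ∈ frontier E := by
    have h : q₀ ∈ frontier U := by
      rw [hU.frontier_eq]
      exact ⟨mk_lowerBoundary_mem_closure hb ht, fun h => (lowerBoundary_lt hU hb h).false⟩
    rw [hUdef, ← e.coe_toHomeomorph, ← Homeomorph.image_frontier,
      hE.frontier_interior_eq hint] at h
    obtain ⟨y, hy, hyq⟩ := h
    rw [← hyq]
    simpa using hy
  let L (m : ℝ) : Plane →L[ℝ] ℝ :=
    (m • ContinuousLinearMap.fst ℝ ℝ ℝ - ContinuousLinearMap.snd ℝ ℝ ℝ).comp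
      (e : Plane →L[ℝ] ℝ × ℝ)
  have hLapp (m : ℝ) (y : Plane) : L m y = m * (e y).1 - (e y).2 := by simp [L]
  have hL (m : ℝ) (hm : ∀ x ∈ Prod.fst '' U, lowerBoundary U t + m * (x - t) ≤ lowerBoundary U x) :
      ∀ y ∈ E, L m (y - e.symm q₀) ≤ 0 := by
    have hcl : IsClosed {y | L m (y - e.symm q₀) ≤ 0} :=
      isClosed_le (by fun_prop) continuous_const
    have hi : interior E ⊆ {y | L m (y - e.symm q₀) ≤ 0} := by
      intro y hy
      have hyU : e y ∈ U := ⟨y, hy, rfl⟩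
      have h1 := hm _ ⟨_, hyU, rfl⟩
      have h2 := lowerBoundary_lt hU hb (t := (e y).1) (u := (e y).2) hyU
      rw [Set.mem_ofPred_eq, hLapp, map_sub, e.apply_symm_apply, hq₀]
      simp only [Prod.fst_sub, Prod.snd_sub]
      linarith
    intro y hy
    have := closure_minimal hi hcl
    rw [hE.closure_interior_eq_closure_of_nonempty_interior hint] at this
    exact this (subset_closure hy)
  -- In the direction of mean slope the two functionals take the opposite values `±(m₁ - m₂) / 2`.
  have := hcorner _ hq₀f (L m₁) (L m₂) (e.symm (1, (m₁ + m₂) / 2)) (hL m₁ h₁) (hL m₂ h₂)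
    (by rw [hLapp, e.apply_symm_apply]; dsimp only; linarith)
  rw [hLapp, e.apply_symm_apply] at this
  dsimp only at this
  linarith

/-- A bounded convex body without corners has `C¹` boundary. -/
theorem hasC1Boundary_of_not_corner {E : Set Plane} (hbdd : Bornology.IsBounded E)
    (hE : Convex ℝ E) (hint : (interior E).Nonempty)
    (hcorner : ∀ x₀ ∈ frontier E, ∀ (L₁ L₂ : Plane →L[ℝ] ℝ) (v : Plane),
      (∀ y ∈ E, L₁ (y - x₀) ≤ 0) → (∀ y ∈ E, L₂ (y - x₀) ≤ 0) → 0 < L₁ v → 0 ≤ L₂ v) :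
    HasC1Boundary E := by
  intro x hx
  obtain ⟨z, hz⟩ := id hint
  have hzx : z - x ≠ 0 := sub_ne_zero.2 fun h => hx.2 (h ▸ hz)
  -- Rotate so that the interior point `z` lies vertically above `x`; nearby vertical lines then
  -- meet the interior at the height of `z`.
  obtain ⟨A, hA0, hA1⟩ := exists_linearIsometryEquiv_apply_eq_smul hzx
  set e := planeCoordinates A
  set U := e '' interior E with hUdef
  have hU : IsOpen U := e.toHomeomorph.isOpenMap _ isOpen_interior
  have hc : Convex ℝ U := hE.interior.linear_image (e : Plane →ₗ[ℝ] ℝ × ℝ)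
  obtain ⟨C, hC⟩ := ((e : Plane →L[ℝ] ℝ × ℝ).lipschitz.isBounded_image
    (hbdd.subset interior_subset)).exists_norm_le
  have hb : ∀ q ∈ U, -C ≤ q.2 := fun q hq =>
    (abs_le.1 ((norm_snd_le q).trans (hC q hq))).1
  have hzU : e z ∈ U := ⟨z, hz, rfl⟩
  have hfst : (e z).1 = (e x).1 := by
    have : (A z) 0 - (A x) 0 = 0 := by simpa using hA0
    exact sub_eq_zero.1 this
  have hsnd : (e x).2 < (e z).2 := by
    have : (A z) 1 - (A x) 1 = ‖z - x‖ := by simpa using hA1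
    have h := norm_pos_iff.2 hzx
    rw [← this] at h
    exact sub_pos.1 h
  obtain ⟨g, hg, δ, hδ, hgf⟩ :=
    (contDiffOn_lowerBoundary_of_not_corner hE hint hcorner e hb).exists_contDiff_eqOn_ball
      (isOpenMap_fst U hU) (t := (e x).1) ⟨_, hzU, hfst⟩
  have hnhds : ∀ᶠ y in 𝓝 x, (((e y).1, (e z).2) ∈ U ∧ (e y).2 < (e z).2) ∧
      (e y).1 ∈ Metric.ball (e x).1 δ := by
    refine Filter.Eventually.and (Filter.Eventually.and ?_ ?_) ?_
    · have hcont : ContinuousAt (fun y => ((e y).1, (e z).2)) x := by fun_prop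
      exact hcont (hU.mem_nhds (by beta_reduce; rw [← hfst]; exact hzU))
    · have hcont : ContinuousAt (fun y => (e y).2) x := by fun_prop
      exact hcont.eventually_lt_const hsnd
    · have hcont : ContinuousAt (fun y => (e y).1) x := by fun_prop
      exact hcont (Metric.ball_mem_nhds _ hδ)
  obtain ⟨r, hr, hball⟩ := Metric.eventually_nhds_iff_ball.1 hnhds
  refine ⟨A, g, r, hg, hr, fun y hy => ?_⟩
  obtain ⟨⟨h1, h2⟩, h3⟩ := hball y hy
  obtain ⟨hfr, hmem⟩ := mem_frontier_and_mem_iff_of_lowerBoundary hU hc hb h1 h2.le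
  rw [← hgf _ h3] at hfr hmem
  constructor
  · refine Iff.trans ?_ hfr
    rw [hUdef, ← e.coe_toHomeomorph, ← Homeomorph.image_frontier, hE.frontier_interior_eq hint]
    exact (e.injective.mem_set_image (s := frontier E)).symm
  · refine Iff.trans ?_ hmem
    exact (e.injective.mem_set_image (s := interior E)).symm

theorem mainTheorem6 (E : Set Plane) (hE_bdd : Bornology.IsBounded E) (hE_conv : Convex ℝ E)
    (hE_int : (interior E).Nonempty) (s p : ℝ) (hs0 : 0 < s) (hs1 : s < 1) (hp : 1 / s ≤ p)
    (hfin : nonlocalWillmoreEnergy s p E < ∞) :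
    HasC1Boundary E :=
  hasC1Boundary_of_not_corner hE_bdd hE_conv hE_int fun _ hx₀ _ _ _ h₁ h₂ hv =>
    not_corner_of_nonlocalWillmoreEnergy_lt_top hs0 hp hE_conv hE_int hfin hx₀ h₁ h₂ hv
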